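/- Equip $[0,1]$ with Lebesgue measure $\lambda$ and let $(\Omega,\mathcal P)=\prod_{n=0}^\infty([0,1],\lambda)$. Let $\{B_n\}_{n=1}^\infty$ be pairwise disjoint measurable subsets of $[0,1]$ with $\lambda(B_n)=\frac1{e\,n!}$. The Kruglov operator $K$ sends a measurable function $f:[0,1]\to\mathbb R$ to the function $$Kf(\omega_0,\omega_1,\ldots)=\sum_{n=1}^\infty\sum_{k=1}^n f(\omega_k)\,\chi_{B_n}(\omega_0)$$ on $\Omega$. For a measurable real function $f$ on a probability space $(S,\mu)$ let $f^*(t)=\inf\{\tau\ge 0:\mu\{|f|>\tau\}\le t\}$ be its decreasing rearrangement. For $p\ge1$ let the Lorentz space $\Lambda(t^{1/p})$ over $(S,\mu)$ consist of those $f$ with $$\|f\|_{\Lambda(t^{1/p})}=\int_0^1 f^*(s)\,d(s^{1/p})<\infty .$$ There is a universal constant $C>0$, independent also of the choice of $\{B_n\}$, such that for every real $p\ge1$ the operator $K$ maps $\Lambda(t^{1/p})$ over $([0,1],\lambda)$ into $\Lambda(t^{1/p})$ over $(\Omega,\mathcal P)$, and $$\|K\|_{\Lambda(t^{1/p})\to\Lambda(t^{1/p})}:=\sup\bigl\{\|Kf\|_{\Lambda(t^{1/p})}:\|f\|_{\Lambda(t^{1/p})}\le1\bigr\}\le\frac{Cp}{\ln(p+1)}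 .$$ -/

import Mathlib

open MeasureTheory Set
open scoped ENNReal

noncomputable section

namespace Kruglov

/-- The decreasing rearrangement of `|f|` on a measure space:
`f*(t) = inf {τ ≥ 0 : μ {|f| > τ} ≤ t}`, with values in `[0, ∞]`. -/
def rearrangement {Ω : Type*} [MeasurableSpace Ω] (μ : Measure Ω) (f : Ω → ℝ) (t : ℝ) : ℝ≥0∞ :=
  sInf {τ : ℝ≥0∞ | μ {x | τ < ‖f x‖ₑ} ≤ ENNReal.ofReal t}

/-- The Lorentz norm `‖f‖_{Λ(ψ)} = ∫₀¹ f*(s) dψ(s)` (a Lebesgue-Stieltjes integral), for a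
function on a probability space. It is `∞` when the integral diverges. -/
def lorentzNorm {Ω : Type*} [MeasurableSpace Ω] (ψ : StieltjesFunction ℝ) (μ : Measure Ω)
    (f : Ω → ℝ) : ℝ≥0∞ :=
  ∫⁻ s in Ioc (0 : ℝ) 1, rearrangement μ f s ∂ψ.measure

/-- The Lorentz space `Λ(ψ)` over a probability space: the measurable functions with finite
Lorentz norm. -/
def lorentzSpace {Ω : Type*} [MeasurableSpace Ω] (ψ : StieltjesFunction ℝ) (μ : Measure Ω) :
    Set (Ω → ℝ) :=
  {f | AEMeasurable f μ ∧ lorentzNorm ψ μ f < ∞}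

/-- The norm `‖T‖_{Λ(ψ) → Λ(ψ)}` of an operator from functions on `(Ω, μ)` to functions on
`(Ω', ν)`: the supremum of `‖T f‖` over the unit ball of `Λ(ψ)` on `(Ω, μ)`. -/
def lorentzOpNorm {Ω Ω' : Type*} [MeasurableSpace Ω] [MeasurableSpace Ω']
    (ψ : StieltjesFunction ℝ) (μ : Measure Ω) (ν : Measure Ω') (T : (Ω → ℝ) → (Ω' → ℝ)) : ℝ≥0∞ :=
  ⨆ f ∈ lorentzSpace ψ μ, ⨆ _ : lorentzNorm ψ μ f ≤ 1, lorentzNorm ψ ν (T f)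

/-- The function `ψ(t) = t^{1/p}` for `t ≥ 0`, extended by `ψ(t) = 0` for `t < 0`. -/
def powStieltjes (p : ℝ) (hp : 1 ≤ p) : StieltjesFunction ℝ where
  toFun t := (max t 0) ^ (1 / p)
  mono' := fun _ _ h => Real.rpow_le_rpow (le_max_right _ _) (max_le_max_right 0 h)
    (by positivity)
  right_continuous' := fun _ =>
    ((Real.continuous_rpow_const (by positivity)).comp
      (continuous_id.max continuous_const)).continuousWithinAt

/-- A sequence `B₁, B₂, …` of pairwise disjoint (Lebesgue) measurable subsets of `[0,1]` with
`λ(Bₙ) = 1 / (e n!)`. The value `B 0` plays no role. -/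
structure IsKruglovSequence (B : ℕ → Set unitInterval) : Prop where
  measurable : ∀ n, 1 ≤ n → NullMeasurableSet (B n) volume
  disjoint : (Ici 1).PairwiseDisjoint B
  measure_eq : ∀ n, 1 ≤ n →
    volume (B n) = ENNReal.ofReal (1 / (Real.exp 1 * (Nat.factorial n : ℝ)))

/-- The product `(Ω, 𝒫) = ∏_{n ≥ 0} ([0,1], λ)`. -/
def prodMeasure : Measure (ℕ → unitInterval) :=
  Measure.infinitePi fun _ : ℕ => (volume : Measure unitInterval)

/-- The Kruglov operator
`K f (ω₀, ω₁, …) = ∑_{n ≥ 1} ∑_{k = 1}^n f(ω_k) χ_{Bₙ}(ω₀)`.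
The term `n = 0` is an empty sum; for pairwise disjoint `Bₙ` at most one term is nonzero. -/
def kruglovOp (B : ℕ → Set unitInterval) (f : unitInterval → ℝ) : (ℕ → unitInterval) → ℝ :=
  fun ω => ∑' n : ℕ, ∑ k ∈ Finset.Icc 1 n, f (ω k) * (B n).indicator 1 (ω 0)

end Kruglov

end

/-! In terms of the distribution function, the norm of `Λ(t^{1/p})` is `∫₀^∞ μ{|f| > τ}^{1/p} dτ`
(`lorentzNorm_powStieltjes`). Since `t^{1/p}` is concave, this functional is countably subadditive
(`tailNorm_tsum_le`). Bounding `|f|` by a dyadic sum of indicators of its superlevel sets, at the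
cost of a factor 4, reduces the estimate to indicators.

For `f = χ_A`, `Kf` counts the points falling in `A` among a Poisson(1) number of independent
samples. A union bound gives `P(Kf > j) ≤ λ(A)^{j+1} / (j+1)!` (`tail_kruglovENN_indicator_le`).
Taking powers `1/p` and summing over `j` leaves `λ(A)^{1/p} ∑ (1/(j+1)!)^{1/p}`, and a geometric
series bounds the last sum by `e² p / ln(p+1)` (`tsum_inv_factorial_rpow_le`). -/

namespace Kruglov

/-! ### Layer cake formulas. -/

section Tail

variable {Ω : Type*} [MeasurableSpace Ω] {μ : Measure Ω}

/-- The functional `∫₀^∞ μ{F > τ}^{1/p} dτ`, i.e. the Lorentz norm of `Λ(t^{1/p})` in terms of the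
distribution function. -/
noncomputable def tailNorm (p : ℝ) (μ : Measure Ω) (F : Ω → ℝ≥0∞) : ℝ≥0∞ :=
  ∫⁻ τ in Ioi (0 : ℝ), μ {ω | ENNReal.ofReal τ < F ω} ^ (1 / p)

lemma volume_Ioi_inter_ofReal_lt (x : ℝ≥0∞) :
    volume (Ioi (0 : ℝ) ∩ {τ | ENNReal.ofReal τ < x}) = x := by
  induction x with
  | top => simp
  | coe x =>
    have : Ioi (0 : ℝ) ∩ {τ | ENNReal.ofReal τ < x} = Ioo 0 (x : ℝ) := by
      ext τ
      simp only [mem_inter_iff, mem_Ioi, mem_ofPred_eq, mem_Ioo]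
      refine and_congr_right fun h => ?_
      rw [← ENNReal.ofReal_coe_nnreal, ENNReal.ofReal_lt_ofReal_iff_of_nonneg h.le]
    rw [this, Real.volume_Ioo]
    simp

lemma antitone_tail (μ : Measure Ω) (F : Ω → ℝ≥0∞) :
    Antitone fun τ : ℝ => μ {ω | ENNReal.ofReal τ < F ω} := fun _ _ h =>
  measure_mono fun _ hω => (ENNReal.ofReal_le_ofReal h).trans_lt hω

/-- The layer cake formula for functions with values in `[0, ∞]`. -/
lemma lintegral_eq_lintegral_tail [SFinite μ] {F : Ω → ℝ≥0∞} (hF : AEMeasurable F μ) :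
    ∫⁻ ω, F ω ∂μ = ∫⁻ τ in Ioi (0 : ℝ), μ {ω | ENNReal.ofReal τ < F ω} := by
  wlog hm : Measurable F generalizing F
  · rw [lintegral_congr_ae hF.ae_eq_mk, this hF.measurable_mk.aemeasurable hF.measurable_mk]
    refine lintegral_congr fun τ => measure_congr ?_
    filter_upwards [hF.ae_eq_mk] with ω hω
    exact congrArg (fun x => ENNReal.ofReal τ < x) hω.symm
  have hS : MeasurableSet {q : Ω × ℝ | ENNReal.ofReal q.2 < F q.1} :=
    measurableSet_lt (by fun_prop) (by fun_prop)
  have h1 : ∀ ω, F ω = ∫⁻ τ in Ioi (0 : ℝ),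
      {q : Ω × ℝ | ENNReal.ofReal q.2 < F q.1}.indicator 1 (ω, τ) := fun ω => by
    have : (fun τ : ℝ => {q : Ω × ℝ | ENNReal.ofReal q.2 < F q.1}.indicator
        (1 : Ω × ℝ → ℝ≥0∞) (ω, τ)) = {τ : ℝ | ENNReal.ofReal τ < F ω}.indicator 1 := rfl
    have hms : MeasurableSet {τ : ℝ | ENNReal.ofReal τ < F ω} :=
      measurableSet_lt (by fun_prop) (by fun_prop)
    rw [this, lintegral_indicator_one hms, Measure.restrict_apply hms, inter_comm,
      volume_Ioi_inter_ofReal_lt]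
  rw [lintegral_congr h1, lintegral_lintegral_swap]
  · refine lintegral_congr fun τ => ?_
    have : (fun ω => {q : Ω × ℝ | ENNReal.ofReal q.2 < F q.1}.indicator
        (1 : Ω × ℝ → ℝ≥0∞) (ω, τ)) = {ω | ENNReal.ofReal τ < F ω}.indicator 1 := rfl
    rw [this, lintegral_indicator_one (measurableSet_lt (by fun_prop) hm)]
  · exact (measurable_one.indicator hS).aemeasurable

lemma lintegral_tsub_eq_lintegral_tail [SFinite μ] {F : Ω → ℝ≥0∞} (hF : AEMeasurable F μ)
    (c : NNReal) :
    ∫⁻ ω, (F ω - c) ∂μ = ∫⁻ τ in Ioi (c : ℝ), μ {ω | ENNReal.ofReal τ < F ω} := by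
  rw [lintegral_eq_lintegral_tail (hF.sub_const _)]
  have h := (measurePreserving_add_right volume (c : ℝ)).setLIntegral_comp_preimage_emb
    (MeasurableEquiv.addRight (c : ℝ)).measurableEmbedding
    (fun τ => μ {ω | ENNReal.ofReal τ < F ω}) (Ioi (c : ℝ))
  rw [← h]
  have hpre : (fun x : ℝ => x + c) ⁻¹' Ioi (c : ℝ) = Ioi 0 := by ext; simp
  rw [hpre]
  refine setLIntegral_congr_fun measurableSet_Ioi fun τ hτ => ?_
  simp only [lt_tsub_iff_right]
  have h2 : ENNReal.ofReal (τ + c) = ENNReal.ofReal τ + c := by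
    rw [ENNReal.ofReal_add (le_of_lt hτ) c.coe_nonneg, ENNReal.ofReal_coe_nnreal]
  rw [← h2]

/-! ### Subadditivity of the Lorentz functional. -/

/-- The functional `∫₀^∞ min(μ{F > τ}, v) dτ`, equal to `∫₀^v F*(s) ds`. -/
noncomputable def truncTail (μ : Measure Ω) (F : Ω → ℝ≥0∞) (v : ℝ≥0∞) : ℝ≥0∞ :=
  ∫⁻ τ in Ioi (0 : ℝ), min (μ {ω | ENNReal.ofReal τ < F ω}) v

lemma lintegral_Ioi_split (c : NNReal) (g : ℝ → ℝ≥0∞) :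
    ∫⁻ τ in Ioi (0 : ℝ), g τ = (∫⁻ τ in Ioc (0 : ℝ) c, g τ) + ∫⁻ τ in Ioi (c : ℝ), g τ := by
  rw [← Ioc_union_Ioi_eq_Ioi c.coe_nonneg, lintegral_union measurableSet_Ioi Ioc_disjoint_Ioi_same]

/-- Bound the minimum by `v` below level `c` and by the tail above it. With the next lemma,
`truncTail` is the minimum over `c` of the right-hand side, a form in which subadditivity is
visible. -/
lemma truncTail_le [SFinite μ] {F : Ω → ℝ≥0∞} (hF : AEMeasurable F μ) {v : ℝ≥0∞} (hv : v ≠ 0)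
    (c : ℝ≥0∞) : truncTail μ F v ≤ c * v + ∫⁻ ω, (F ω - c) ∂μ := by
  induction c with
  | top => simp [ENNReal.top_mul hv]
  | coe c =>
    rw [lintegral_tsub_eq_lintegral_tail hF, truncTail, lintegral_Ioi_split c]
    gcongr
    · calc _ ≤ ∫⁻ τ in Ioc (0 : ℝ) c, v := lintegral_mono fun _ => min_le_right _ _
        _ = c * v := by simp [mul_comm]
    · exact min_le_left _ _

lemma exists_le_truncTail [SFinite μ] {F : Ω → ℝ≥0∞} (hF : AEMeasurable F μ) {v : ℝ≥0∞}
    (hv : v ≠ 0) : ∃ c : ℝ≥0∞, c * v + ∫⁻ ω, (F ω - c) ∂μ ≤ truncTail μ F v := by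
  -- The optimal level is `F*(v)`: the tail is at least `v` below it and at most `v` above it.
  obtain ⟨c, hc⟩ : ∃ c, c = sInf {τ : ℝ≥0∞ | μ {ω | τ < F ω} ≤ v} := ⟨_, rfl⟩
  have hlt : ∀ τ : ℝ, ENNReal.ofReal τ < c → v ≤ μ {ω | ENNReal.ofReal τ < F ω} := by
    intro τ hτ
    by_contra! h
    exact (hτ.trans_le (hc ▸ sInf_le h.le)).false
  have hgt : ∀ τ : ℝ, c < ENNReal.ofReal τ → μ {ω | ENNReal.ofReal τ < F ω} ≤ v := by
    intro τ hτ
    rw [hc, sInf_lt_iff] at hτ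
    obtain ⟨σ, hσ, hστ⟩ := hτ
    exact (measure_mono fun ω hω => hστ.trans hω).trans hσ
  refine ⟨c, ?_⟩
  clear hc
  induction c with
  | top =>
    have : truncTail μ F v = ⊤ := by
      rw [truncTail, lintegral_congr fun τ => min_eq_right (hlt τ ENNReal.ofReal_lt_top)]
      simp [ENNReal.mul_top hv]
    rw [this]
    exact le_top
  | coe c =>
    rw [lintegral_tsub_eq_lintegral_tail hF, truncTail, lintegral_Ioi_split c]
    gcongr ?_ + ?_
    · calc (c : ℝ≥0∞) * v = ∫⁻ τ in Ioo (0 : ℝ) c, v := by simp [mul_comm]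
        _ ≤ ∫⁻ τ in Ioo (0 : ℝ) c, min (μ {ω | ENNReal.ofReal τ < F ω}) v := by
          refine setLIntegral_mono' measurableSet_Ioo fun τ hτ => le_min (hlt τ ?_) le_rfl
          rw [← ENNReal.ofReal_coe_nnreal, ENNReal.ofReal_lt_ofReal_iff_of_nonneg hτ.1.le]
          exact hτ.2
        _ ≤ _ := lintegral_mono_set Ioo_subset_Ioc_self
    · refine setLIntegral_mono' measurableSet_Ioi fun τ hτ => le_min le_rfl (hgt τ ?_)
      rw [← ENNReal.ofReal_coe_nnreal, ENNReal.ofReal_lt_ofReal_iff (c.coe_nonneg.trans_lt hτ)]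
      exact hτ

/-- The sum of the optimal levels `c i` is an admissible level for the sum, and `(∑ F i - ∑ c i)⁺ ≤
∑ (F i - c i)⁺`. -/
lemma truncTail_tsum_le [SFinite μ] {ι : Type*} [Countable ι] {F : ι → Ω → ℝ≥0∞}
    (hF : ∀ i, AEMeasurable (F i) μ) {v : ℝ≥0∞} (hv : v ≠ 0) :
    truncTail μ (fun ω => ∑' i, F i ω) v ≤ ∑' i, truncTail μ (F i) v := by
  choose c hc using fun i => exists_le_truncTail (hF i) hv
  calc _ ≤ (∑' i, c i) * v + ∫⁻ ω, (∑' i, F i ω) - (∑' i, c i) ∂μ :=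
        truncTail_le (AEMeasurable.tsum hF) hv _
    _ ≤ (∑' i, c i) * v + ∫⁻ ω, ∑' i, (F i ω - c i) ∂μ := by
        gcongr with ω
        rw [tsub_le_iff_right, ← ENNReal.tsum_add]
        exact ENNReal.tsum_le_tsum fun i => le_tsub_add
    _ = ∑' i, (c i * v + ∫⁻ ω, (F i ω - c i) ∂μ) := by
        rw [lintegral_tsum fun i => (hF i).sub_const _, ENNReal.tsum_add, ENNReal.tsum_mul_right]
    _ ≤ _ := ENNReal.tsum_le_tsum hc

/-- The power `t^{1/p}` is a mixture of the functions `min(t, v)`. -/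
lemma rpow_eq_lintegral_min {p : ℝ} (hp : 1 < p) {t : ℝ≥0∞} (ht : t ≠ ⊤) :
    t ^ (1 / p) = ∫⁻ v in Ioi (0 : ℝ),
      min t (ENNReal.ofReal v) * ENNReal.ofReal ((p - 1) / p ^ 2 * v ^ (1 / p - 2)) := by
  have hp0 : 0 < p := by linarith
  have hp1 : 1 / p < 1 := by rw [div_lt_one hp0]; exact hp
  have hp2 : 0 < 1 / p := by positivity
  lift t to NNReal using ht
  rcases eq_or_ne t 0 with rfl | h0
  · simp [hp0]
  have ht : 0 < (t : ℝ) := by positivity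
  -- The density is minus the second derivative of `v^{1/p}`. The ranges `v ≤ t` and `v > t`
  -- contribute the fractions `(p-1)/p` and `1/p` of `t^{1/p}`.
  have hk : 0 ≤ (p - 1) / p ^ 2 := div_nonneg (by linarith) (by positivity)
  rw [lintegral_Ioi_split t]
  have h1 : ∫⁻ v in Ioc (0 : ℝ) t, min (t : ℝ≥0∞) (ENNReal.ofReal v) *
      ENNReal.ofReal ((p - 1) / p ^ 2 * v ^ (1 / p - 2)) =
      ENNReal.ofReal ((p - 1) / p * (t : ℝ) ^ (1 / p)) := by
    have hint : IntegrableOn (fun v : ℝ => (p - 1) / p ^ 2 * v ^ (1 / p - 1)) (Ioc 0 t) := by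
      rw [← intervalIntegrable_iff_integrableOn_Ioc_of_le ht.le]
      exact (intervalIntegral.intervalIntegrable_rpow' (by linarith)).const_mul _
    rw [← ENNReal.ofReal_coe_nnreal]
    rw [setLIntegral_congr_fun (g := fun v => ENNReal.ofReal ((p - 1) / p ^ 2 * v ^ (1 / p - 1)))
      measurableSet_Ioc, ← ofReal_integral_eq_lintegral_ofReal hint]
    · rw [← intervalIntegral.integral_of_le ht.le, intervalIntegral.integral_const_mul,
        integral_rpow (Or.inl (by linarith))]
      congr 1
      rw [sub_add_cancel, Real.zero_rpow hp2.ne']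
      field_simp
      ring
    · filter_upwards [ae_restrict_mem measurableSet_Ioc] with v hv
      have := hv.1.le
      positivity
    · intro v hv
      have hv0 := hv.1
      simp only
      rw [min_eq_right (ENNReal.ofReal_le_ofReal hv.2), ← ENNReal.ofReal_mul hv0.le]
      congr 1
      rw [show 1 / p - 1 = (1 / p - 2) + 1 by ring, Real.rpow_add_one hv0.ne']
      ring
  have h2 : ∫⁻ v in Ioi (t : ℝ), min (t : ℝ≥0∞) (ENNReal.ofReal v) *
      ENNReal.ofReal ((p - 1) / p ^ 2 * v ^ (1 / p - 2)) =
      ENNReal.ofReal (1 / p * (t : ℝ) ^ (1 / p)) := by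
    have hint : IntegrableOn (fun v : ℝ => t * ((p - 1) / p ^ 2 * v ^ (1 / p - 2))) (Ioi t) :=
      ((integrableOn_Ioi_rpow_of_lt (by linarith) ht).const_mul _).const_mul _
    rw [← ENNReal.ofReal_coe_nnreal]
    rw [setLIntegral_congr_fun
      (g := fun v => ENNReal.ofReal (t * ((p - 1) / p ^ 2 * v ^ (1 / p - 2))))
      measurableSet_Ioi, ← ofReal_integral_eq_lintegral_ofReal hint]
    · rw [integral_const_mul, integral_const_mul, integral_Ioi_rpow_of_lt (by linarith) ht]
      congr 1
      have h4 : (t : ℝ) ^ (1 / p) = (t : ℝ) ^ (1 / p - 2 + 1) * t := by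
        rw [← Real.rpow_add_one ht.ne']
        congr 1
        ring
      rw [h4]
      generalize (t : ℝ) ^ (1 / p - 2 + 1) = y
      have : p - 1 ≠ 0 := by linarith
      have h3 : 1 / p - 2 + 1 = - ((p - 1) / p) := by field_simp; ring
      rw [h3]
      field_simp
    · filter_upwards [ae_restrict_mem measurableSet_Ioi] with v hv
      have := ht.trans hv
      positivity
    · intro v hv
      simp only
      rw [min_eq_left (ENNReal.ofReal_le_ofReal (le_of_lt hv)), ← ENNReal.ofReal_mul ht.le]
  rw [h1, h2, ← ENNReal.ofReal_coe_nnreal, ENNReal.ofReal_rpow_of_pos ht, ← ENNReal.ofReal_add]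
  · congr 1
    field_simp
    ring
  · have : 0 ≤ p - 1 := by linarith
    positivity
  · positivity

lemma tailNorm_eq_lintegral_truncTail [IsFiniteMeasure μ] {p : ℝ} (hp : 1 < p)
    (F : Ω → ℝ≥0∞) :
    tailNorm p μ F = ∫⁻ v in Ioi (0 : ℝ), truncTail μ F (ENNReal.ofReal v) *
      ENNReal.ofReal ((p - 1) / p ^ 2 * v ^ (1 / p - 2)) := by
  have hm := (antitone_tail μ F).measurable
  simp only [tailNorm, rpow_eq_lintegral_min hp (measure_ne_top μ _)]
  rw [lintegral_lintegral_swap]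
  · refine lintegral_congr fun v => ?_
    rw [lintegral_mul_const _ (hm.min measurable_const), truncTail]
  · refine Measurable.aemeasurable (Measurable.mul ?_ (by fun_prop))
    exact (hm.comp measurable_fst).min (by fun_prop)

/-- The countable triangle inequality for `tailNorm`. -/
lemma tailNorm_tsum_le [IsFiniteMeasure μ] {p : ℝ} (hp : 1 ≤ p) {ι : Type*} [Countable ι]
    {F : ι → Ω → ℝ≥0∞} (hF : ∀ i, AEMeasurable (F i) μ) :
    tailNorm p μ (fun ω => ∑' i, F i ω) ≤ ∑' i, tailNorm p μ (F i) := by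
  -- At `p = 1` the mixing density vanishes, but the functional is then the integral itself.
  rcases hp.eq_or_lt with rfl | hp
  · simp only [tailNorm, div_one, ENNReal.rpow_one]
    rw [← lintegral_eq_lintegral_tail (AEMeasurable.tsum hF), lintegral_tsum hF]
    exact ENNReal.tsum_le_tsum fun i => (lintegral_eq_lintegral_tail (hF i)).le
  · simp only [tailNorm_eq_lintegral_truncTail hp]
    have hmono : ∀ i, Measurable fun v : ℝ => truncTail μ (F i) (ENNReal.ofReal v) := fun i =>
      Monotone.measurable fun v w h =>
        lintegral_mono fun τ => min_le_min_left _ (ENNReal.ofReal_le_ofReal h)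
    rw [← lintegral_tsum fun i => by have := hmono i; fun_prop]
    refine setLIntegral_mono' measurableSet_Ioi fun v hv => ?_
    rw [ENNReal.tsum_mul_right]
    gcongr
    exact truncTail_tsum_le hF (by simpa using hv)

lemma tailNorm_mono {p : ℝ} (hp : 1 ≤ p) {F G : Ω → ℝ≥0∞} (h : ∀ᵐ ω ∂μ, F ω ≤ G ω) :
    tailNorm p μ F ≤ tailNorm p μ G := by
  refine lintegral_mono fun τ => ENNReal.rpow_le_rpow (measure_mono_ae ?_) (by positivity)
  filter_upwards [h] with ω hω hτ using lt_of_lt_of_le hτ hω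

lemma tailNorm_const_mul (p : ℝ) {c : ℝ} (hc : 0 < c) (F : Ω → ℝ≥0∞) :
    tailNorm p μ (fun ω => ENNReal.ofReal c * F ω) = ENNReal.ofReal c * tailNorm p μ F := by
  have h1 : ∀ τ ∈ Ioi (0 : ℝ), μ {ω | ENNReal.ofReal τ < ENNReal.ofReal c * F ω} ^ (1 / p) =
      (fun σ => μ {ω | ENNReal.ofReal σ < F ω} ^ (1 / p)) (c⁻¹ * τ) := by
    intro τ hτ
    simp only
    congr 3
    ext ω
    rw [ENNReal.ofReal_mul (by positivity), ENNReal.ofReal_inv_of_pos hc,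
      mul_comm _ (ENNReal.ofReal τ), ← div_eq_mul_inv, ENNReal.div_lt_iff, mul_comm]
    · left; simpa using hc
    · left; simp
  rw [tailNorm, setLIntegral_congr_fun measurableSet_Ioi h1, tailNorm]
  have hm : Measurable fun σ : ℝ => μ {ω | ENNReal.ofReal σ < F ω} ^ (1 / p) :=
    (antitone_tail μ F).measurable.pow_const _
  rw [← lintegral_indicator measurableSet_Ioi, ← lintegral_indicator measurableSet_Ioi]
  have h2 : (Ioi (0 : ℝ)).indicator (fun τ => (fun σ => μ {ω | ENNReal.ofReal σ < F ω} ^ (1 / p))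
      (c⁻¹ * τ)) = fun τ => ((Ioi (0 : ℝ)).indicator
        (fun σ => μ {ω | ENNReal.ofReal σ < F ω} ^ (1 / p))) (c⁻¹ * τ) := by
    ext τ
    simp only [indicator, mem_Ioi]
    congr 1
    simp [hc]
  rw [h2, ← lintegral_map (hm.indicator measurableSet_Ioi) (by fun_prop),
    Real.map_volume_mul_left (by positivity), lintegral_smul_measure]
  simp [abs_of_pos hc]

/-- The Lorentz norm of `Λ(t^{1/p})` in terms of the distribution function. -/
lemma lorentzNorm_powStieltjes [IsProbabilityMeasure μ] {p : ℝ} (hp : 1 ≤ p) (f : Ω → ℝ) :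
    lorentzNorm (powStieltjes p hp) μ f = tailNorm p μ fun ω => ‖f ω‖ₑ := by
  have hp0 : 0 < p := by linarith
  have hanti : Antitone (rearrangement μ f) := fun s t h =>
    sInf_le_sInf fun τ hτ => hτ.trans (ENNReal.ofReal_le_ofReal h)
  -- The rearrangement and the distribution function are generalized inverses. The delicate case is
  -- `τ = f*(s)`, where continuity of `μ` from below shows that the infimum is attained.
  have hiff : ∀ (s τ : ℝ), ENNReal.ofReal τ < rearrangement μ f s ↔
      ENNReal.ofReal s < μ {ω | ENNReal.ofReal τ < ‖f ω‖ₑ} := by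
    intro s τ
    constructor
    · intro h
      by_contra! hle
      exact (h.trans_le (sInf_le hle)).false
    · intro h
      by_contra! hle
      refine h.not_ge ?_
      rcases hle.lt_or_eq with hlt | heq
      · obtain ⟨σ, hσ, hστ⟩ := sInf_lt_iff.1 hlt
        exact (measure_mono fun ω hω => hστ.trans hω).trans hσ
      · have hσ : ∀ σ : ℝ≥0∞, ENNReal.ofReal τ < σ →
            μ {ω | σ < ‖f ω‖ₑ} ≤ ENNReal.ofReal s := by
          intro σ hσ
          rw [← heq] at hσ
          obtain ⟨σ', h', hσ'⟩ := sInf_lt_iff.1 hσ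
          exact (measure_mono fun ω hω => hσ'.trans hω).trans h'
        obtain ⟨u, hu, hut, hlim⟩ := exists_seq_strictAnti_tendsto'
          (ENNReal.ofReal_lt_top (r := τ))
        have hU : {ω | ENNReal.ofReal τ < ‖f ω‖ₑ} = ⋃ n, {ω | u n < ‖f ω‖ₑ} := by
          ext ω
          simp only [mem_ofPred_eq, mem_iUnion]
          refine ⟨fun hω => ((hlim.eventually (gt_mem_nhds hω)).exists), ?_⟩
          rintro ⟨n, hn⟩
          exact (hut n).1.trans hn
        rw [hU, Monotone.measure_iUnion]
        · exact iSup_le fun n => hσ _ (hut n).1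
        · exact fun m n hmn ω hω => (hu.antitone hmn).trans_lt hω
  -- Layer cake for the Stieltjes measure: with `m = μ{|f| > τ}`, the superlevel set of `f*` in
  -- `(0,1]` is `(0, m)`, of mass `m^{1/p}`.
  rw [lorentzNorm, lintegral_eq_lintegral_tail hanti.measurable.aemeasurable, tailNorm]
  refine setLIntegral_congr_fun measurableSet_Ioi fun τ _ => ?_
  simp only [hiff]
  have hm1 : μ {ω | ENNReal.ofReal τ < ‖f ω‖ₑ} ≤ 1 := prob_le_one
  generalize μ {ω | ENNReal.ofReal τ < ‖f ω‖ₑ} = m at hm1 ⊢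
  lift m to NNReal using ne_top_of_le_ne_top ENNReal.one_ne_top hm1
  have hm1 : (m : ℝ) ≤ 1 := by exact_mod_cast hm1
  have hms : MeasurableSet {s : ℝ | ENNReal.ofReal s < m} :=
    measurableSet_lt (by fun_prop) (by fun_prop)
  have hset : {s : ℝ | ENNReal.ofReal s < m} ∩ Ioc 0 1 = Ioo 0 (m : ℝ) := by
    ext s
    simp only [mem_inter_iff, mem_ofPred_eq, mem_Ioc, mem_Ioo]
    rw [← ENNReal.ofReal_coe_nnreal]
    constructor
    · rintro ⟨h1, h2, h3⟩
      exact ⟨h2, (ENNReal.ofReal_lt_ofReal_iff_of_nonneg h2.le).1 h1⟩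
    · rintro ⟨h1, h2⟩
      exact ⟨(ENNReal.ofReal_lt_ofReal_iff_of_nonneg h1.le).2 h2, h1, h2.le.trans hm1⟩
  have hcont : Continuous (powStieltjes p hp) :=
    (Real.continuous_rpow_const (by positivity)).comp (continuous_id.max continuous_const)
  rw [Measure.restrict_apply hms, hset, StieltjesFunction.measure_Ioo,
    hcont.continuousWithinAt.leftLim_eq]
  have h0 : powStieltjes p hp 0 = 0 := by
    change (max (0 : ℝ) 0) ^ (1 / p) = 0
    rw [max_self, Real.zero_rpow (by positivity)]
  have h1 : powStieltjes p hp m = (m : ℝ) ^ (1 / p) := by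
    change (max (m : ℝ) 0) ^ (1 / p) = _
    rw [max_eq_left m.coe_nonneg]
  rw [h0, h1, sub_zero, ← ENNReal.ofReal_rpow_of_nonneg m.coe_nonneg (by positivity),
    ENNReal.ofReal_coe_nnreal]

end Tail

/-! ### The Kruglov operator: domination, linearity and measurability. -/

lemma measurePreserving_eval_prodMeasure (k : ℕ) :
    MeasurePreserving (fun ω : ℕ → unitInterval => ω k) prodMeasure volume :=
  measurePreserving_eval_infinitePi _ k

instance : IsProbabilityMeasure prodMeasure := by
  unfold prodMeasure; infer_instance

/-- The Kruglov operator on functions with values in `[0, ∞]`. -/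
noncomputable def kruglovENN (B : ℕ → Set unitInterval) (g : unitInterval → ℝ≥0∞)
    (ω : ℕ → unitInterval) : ℝ≥0∞ :=
  ∑' n : ℕ, ∑ k ∈ Finset.Icc 1 n, g (ω k) * (B n).indicator 1 (ω 0)

lemma enorm_kruglovOp_le (B : ℕ → Set unitInterval) (f : unitInterval → ℝ)
    (ω : ℕ → unitInterval) :
    ‖kruglovOp B f ω‖ₑ ≤ kruglovENN B (fun x => ‖f x‖ₑ) ω := by
  refine (enorm_tsum_le_tsum_enorm).trans (ENNReal.tsum_le_tsum fun n => ?_)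
  refine (enorm_sum_le _ _).trans (Finset.sum_le_sum fun k _ => ?_)
  rw [enorm_mul]
  gcongr
  by_cases h : ω 0 ∈ B n <;> simp [h]

lemma kruglovENN_mono (B : ℕ → Set unitInterval) {g h : unitInterval → ℝ≥0∞} (hgh : g ≤ h)
    (ω : ℕ → unitInterval) : kruglovENN B g ω ≤ kruglovENN B h ω := by
  refine ENNReal.tsum_le_tsum fun n => Finset.sum_le_sum fun k _ => ?_
  gcongr
  exact hgh _

lemma kruglovENN_tsum (B : ℕ → Set unitInterval) {ι : Type*} (g : ι → unitInterval → ℝ≥0∞)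
    (ω : ℕ → unitInterval) :
    kruglovENN B (fun x => ∑' i, g i x) ω = ∑' i, kruglovENN B (g i) ω := by
  unfold kruglovENN
  rw [ENNReal.tsum_comm]
  refine tsum_congr fun n => ?_
  rw [Summable.tsum_finsetSum fun _ _ => ENNReal.summable]
  exact Finset.sum_congr rfl fun k _ => ENNReal.tsum_mul_right.symm

lemma kruglovENN_const_mul (B : ℕ → Set unitInterval) (c : ℝ≥0∞) (g : unitInterval → ℝ≥0∞)
    (ω : ℕ → unitInterval) :
    kruglovENN B (fun x => c * g x) ω = c * kruglovENN B g ω := by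
  unfold kruglovENN
  rw [← ENNReal.tsum_mul_left]
  refine tsum_congr fun n => ?_
  rw [Finset.mul_sum]
  exact Finset.sum_congr rfl fun k _ => mul_assoc _ _ _

variable {B : ℕ → Set unitInterval}

lemma nullMeasurableSet_eval {A : Set unitInterval} (hA : NullMeasurableSet A volume) (k : ℕ) :
    NullMeasurableSet {ω : ℕ → unitInterval | ω k ∈ A} prodMeasure :=
  hA.preimage (measurePreserving_eval_prodMeasure k).quasiMeasurePreserving

lemma aemeasurable_kruglovENN (hB : IsKruglovSequence B) {g : unitInterval → ℝ≥0∞}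
    (hg : AEMeasurable g volume) : AEMeasurable (kruglovENN B g) prodMeasure := by
  refine AEMeasurable.tsum fun n => Finset.aemeasurable_fun_sum _ fun k hk => ?_
  have hn : 1 ≤ n := by have := Finset.mem_Icc.1 hk; omega
  refine AEMeasurable.mul
    (hg.comp_quasiMeasurePreserving (measurePreserving_eval_prodMeasure k).quasiMeasurePreserving) ?_
  exact ((aemeasurable_const (b := (1 : ℝ≥0∞))).indicator₀
    (nullMeasurableSet_eval (hB.measurable n hn) 0))

lemma IsKruglovSequence.eq_of_mem (hB : IsKruglovSequence B) {m n : ℕ} (hm : 1 ≤ m) (hn : 1 ≤ n)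
    {x : unitInterval} (h1 : x ∈ B m) (h2 : x ∈ B n) : m = n := by
  by_contra h
  exact Set.disjoint_left.1 (hB.disjoint hm hn h) h1 h2

lemma aemeasurable_kruglovOp (hB : IsKruglovSequence B) {f : unitInterval → ℝ}
    (hf : AEMeasurable f volume) : AEMeasurable (kruglovOp B f) prodMeasure := by
  refine aemeasurable_of_tendsto_metrizable_ae (u := Filter.atTop) (f := fun N ω =>
    ∑ n ∈ Finset.range N, ∑ k ∈ Finset.Icc 1 n, f (ω k) * (B n).indicator 1 (ω 0)) ?_ ?_
  · intro N
    refine Finset.aemeasurable_fun_sum _ fun n _ => Finset.aemeasurable_fun_sum _ fun k hk => ?_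
    have hn : 1 ≤ n := by have := Finset.mem_Icc.1 hk; omega
    refine AEMeasurable.mul (hf.comp_quasiMeasurePreserving
      (measurePreserving_eval_prodMeasure k).quasiMeasurePreserving) ?_
    exact ((aemeasurable_const (b := (1 : ℝ))).indicator₀
      (nullMeasurableSet_eval (hB.measurable n hn) 0))
  · refine Filter.Eventually.of_forall fun ω => ?_
    refine (Summable.hasSum ?_).tendsto_sum_nat
    -- Disjointness of the `B n` leaves at most one nonzero term.
    refine summable_of_hasFiniteSupport (Set.Subsingleton.finite ?_)
    have key : ∀ n ∈ Function.support (fun n : ℕ =>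
        ∑ k ∈ Finset.Icc 1 n, f (ω k) * (B n).indicator 1 (ω 0)), 1 ≤ n ∧ ω 0 ∈ B n := by
      intro n hn
      constructor
      · by_contra! h0
        obtain rfl : n = 0 := by omega
        simp at hn
      · by_contra h0
        simp [h0] at hn
    intro m hm n hn
    exact hB.eq_of_mem (key m hm).1 (key n hn).1 (key m hm).2 (key n hn).2

/-! ### Poisson tail estimate for indicators. -/

/-- Independence of the coordinates in `{0} ∪ T`, with `0 ∉ T`. Measurable hulls make this work for
arbitrary sets. -/
lemma prodMeasure_block_le (A E : Set unitInterval) {n : ℕ} {T : Finset ℕ}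
    (hT : T ⊆ Finset.Icc 1 n) :
    prodMeasure {ω | ω 0 ∈ E ∧ ∀ k ∈ T, ω k ∈ A} ≤ volume E * volume A ^ T.card := by
  have h0 : 0 ∉ T := fun h => by simpa using hT h
  calc prodMeasure {ω | ω 0 ∈ E ∧ ∀ k ∈ T, ω k ∈ A}
      ≤ prodMeasure (Set.pi (insert 0 T : Finset ℕ) fun k =>
        if k = 0 then toMeasurable volume E else toMeasurable volume A) := by
        refine measure_mono fun ω hω k hk => ?_
        rcases Finset.mem_insert.1 hk with rfl | hk
        · simpa using subset_toMeasurable _ _ hω.1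
        · have : k ≠ 0 := fun h => h0 (h ▸ hk)
          simpa [this] using subset_toMeasurable _ _ (hω.2 k hk)
    _ = volume E * volume A ^ T.card := by
        rw [prodMeasure, Measure.infinitePi_pi, Finset.prod_insert h0]
        · rw [if_pos rfl, measure_toMeasurable, Finset.prod_congr (g := fun _ => volume A) rfl fun k hk => by
            rw [if_neg (fun h : k = 0 => h0 (h ▸ hk)), measure_toMeasurable], Finset.prod_const]
        · intro k _
          split_ifs <;> exact measurableSet_toMeasurable _ _

/-- On `ω 0 ∈ B n` the value is the number of `k ∈ [1, n]` with `ω k ∈ A`; a count above `j`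
contains a set of `j + 1` such indices. -/
lemma exists_of_lt_kruglovENN_indicator (hB : IsKruglovSequence B) {A : Set unitInterval}
    {ω : ℕ → unitInterval} {j : ℕ} (h : (j : ℝ≥0∞) < kruglovENN B (A.indicator 1) ω) :
    ∃ n, ∃ T ∈ (Finset.Icc 1 n).powersetCard (j + 1), ω 0 ∈ B n ∧ ∀ k ∈ T, ω k ∈ A := by
  classical
  by_cases hex : ∃ n, 1 ≤ n ∧ ω 0 ∈ B n
  · obtain ⟨n, hn, hωn⟩ := hex
    have hsum : kruglovENN B (A.indicator 1) ω =
        (((Finset.Icc 1 n).filter fun k => ω k ∈ A).card : ℝ≥0∞) := by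
      rw [kruglovENN, tsum_eq_single n]
      · simp [hωn, Set.indicator_apply]
      · intro m hm
        refine Finset.sum_eq_zero fun k hk => ?_
        have : ω 0 ∉ B m := fun h' =>
          hm (hB.eq_of_mem (by have := Finset.mem_Icc.1 hk; omega) hn h' hωn)
        simp [this]
    rw [hsum, Nat.cast_lt] at h
    obtain ⟨T, hT, hcard⟩ := Finset.exists_subset_card_eq (Nat.succ_le_of_lt h)
    refine ⟨n, T, Finset.mem_powersetCard.2 ⟨hT.trans (Finset.filter_subset _ _), hcard⟩, hωn,
      fun k hk => (Finset.mem_filter.1 (hT hk)).2⟩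
  · exfalso
    have : kruglovENN B (A.indicator 1) ω = 0 := by
      refine ENNReal.tsum_eq_zero.2 fun n => Finset.sum_eq_zero fun k hk => ?_
      have : ω 0 ∉ B n := fun h' =>
        hex ⟨n, by have := Finset.mem_Icc.1 hk; omega, h'⟩
      simp [this]
    simp [this] at h

/-- The binomial moment of a Poisson(1) variable: terms with `n < j` vanish, and `(n+j choose j) /
(n+j)! = 1 / (n! j!)` leaves the series of `e`. -/
lemma tsum_poisson_choose (j : ℕ) :
    ∑' n : ℕ, ENNReal.ofReal (1 / (Real.exp 1 * (Nat.factorial n : ℝ))) * (n.choose j : ℝ≥0∞) =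
      ENNReal.ofReal (1 / (Nat.factorial j : ℝ)) := by
  have h1 : ∀ n, ENNReal.ofReal (1 / (Real.exp 1 * (Nat.factorial n : ℝ))) *
      (n.choose j : ℝ≥0∞) =
      ENNReal.ofReal (1 / (Real.exp 1 * (Nat.factorial n : ℝ)) * (n.choose j : ℝ)) := fun n => by
    rw [ENNReal.ofReal_mul (by positivity), ENNReal.ofReal_natCast]
  have h2 : HasSum (fun n : ℕ => 1 / (Real.exp 1 * (Nat.factorial n : ℝ)) * (n.choose j : ℝ))
      (1 / (Nat.factorial j : ℝ)) := by
    rw [← hasSum_nat_add_iff' j, Finset.sum_eq_zero, sub_zero]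
    · have h3 : HasSum (fun n : ℕ => (1 : ℝ) ^ n / (Nat.factorial n : ℝ)) (Real.exp 1) := by
        rw [Real.exp_eq_exp_ℝ]
        exact NormedSpace.expSeries_div_hasSum_exp (1 : ℝ)
      have h4 := h3.mul_left (1 / (Real.exp 1 * (Nat.factorial j : ℝ)))
      rw [show 1 / (Real.exp 1 * (j.factorial : ℝ)) * Real.exp 1 = 1 / (j.factorial : ℝ) by
        field_simp] at h4
      refine (funext fun n => ?_ : (fun n : ℕ => _) = _) ▸ h4
      have h5 := Nat.add_choose_mul_factorial_mul_factorial n j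
      have h6 : ((n + j).choose j : ℝ) * (n.factorial : ℝ) * (j.factorial : ℝ) =
          ((n + j).factorial : ℝ) := by exact_mod_cast h5
      rw [← h6]
      have : ((n + j).choose j : ℝ) ≠ 0 :=
        Nat.cast_ne_zero.2 (Nat.choose_pos (Nat.le_add_left j n)).ne'
      field_simp
      simp
    · intro n hn
      rw [Nat.choose_eq_zero_of_lt (Finset.mem_range.1 hn)]
      simp
  simp only [h1]
  rw [← ENNReal.ofReal_tsum_of_nonneg (fun n => by positivity) h2.summable, h2.tsum_eq]

lemma tail_kruglovENN_indicator_le (hB : IsKruglovSequence B) (A : Set unitInterval) (j : ℕ) :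
    prodMeasure {ω | (j : ℝ≥0∞) < kruglovENN B (A.indicator 1) ω} ≤
      ENNReal.ofReal (1 / (Nat.factorial (j + 1) : ℝ)) * volume A ^ (j + 1) := by
  calc _ ≤ prodMeasure (⋃ n, ⋃ T ∈ (Finset.Icc 1 n).powersetCard (j + 1),
          {ω | ω 0 ∈ B n ∧ ∀ k ∈ T, ω k ∈ A}) := by
        refine measure_mono fun ω hω => ?_
        obtain ⟨n, T, hT, h⟩ := exists_of_lt_kruglovENN_indicator hB hω
        exact mem_iUnion.2 ⟨n, mem_iUnion₂.2 ⟨T, hT, h⟩⟩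
    _ ≤ ∑' n, ∑ T ∈ (Finset.Icc 1 n).powersetCard (j + 1),
          prodMeasure {ω | ω 0 ∈ B n ∧ ∀ k ∈ T, ω k ∈ A} :=
        (measure_iUnion_le _).trans
          (ENNReal.tsum_le_tsum fun n => measure_biUnion_finset_le _ _)
    _ ≤ ∑' n : ℕ, ENNReal.ofReal (1 / (Real.exp 1 * (Nat.factorial n : ℝ))) *
          (n.choose (j + 1) : ℝ≥0∞) * volume A ^ (j + 1) := by
        refine ENNReal.tsum_le_tsum fun n => ?_
        rcases Nat.eq_zero_or_pos n with rfl | hn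
        · rw [Finset.powersetCard_eq_empty.2 (by simp)]
          simp
        refine (Finset.sum_le_card_nsmul _ _
          (ENNReal.ofReal (1 / (Real.exp 1 * (Nat.factorial n : ℝ))) * volume A ^ (j + 1))
          fun T hT => ?_).trans ?_
        · obtain ⟨hT, hc⟩ := Finset.mem_powersetCard.1 hT
          rw [← hB.measure_eq n hn, ← hc]
          exact prodMeasure_block_le A _ hT
        · rw [Finset.card_powersetCard, Nat.card_Icc, Nat.add_sub_cancel, nsmul_eq_mul]
          exact le_of_eq (by ring)
    _ = _ := by rw [ENNReal.tsum_mul_right, tsum_poisson_choose]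

/-- Apply `x^j / j! ≤ e^x` at `x = p + 1`; the power `1/p` turns `e^{p+1}` into at most `e²`,
uniformly in `p`. -/
lemma inv_factorial_rpow_le {p : ℝ} (hp : 1 ≤ p) (j : ℕ) :
    (1 / (Nat.factorial j : ℝ)) ^ (1 / p) ≤ Real.exp 2 * ((p + 1) ^ (-(1 / p))) ^ j := by
  have hp0 : 0 < p := by linarith
  have h1 : (p + 1) ^ j / (Nat.factorial j : ℝ) ≤ Real.exp (p + 1) :=
    Real.pow_div_factorial_le_exp _ (by positivity) j
  have h2 : 1 / (Nat.factorial j : ℝ) ≤ Real.exp (p + 1) * ((p + 1) ^ j)⁻¹ := by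
    rw [← div_eq_mul_inv, le_div_iff₀ (by positivity)]
    calc _ = _ := by ring
      _ ≤ _ := h1
  calc _ ≤ (Real.exp (p + 1) * ((p + 1) ^ j)⁻¹) ^ (1 / p) :=
        Real.rpow_le_rpow (by positivity) h2 (by positivity)
    _ = Real.exp ((p + 1) * (1 / p)) * ((p + 1) ^ (-(1 / p))) ^ j := by
        rw [Real.mul_rpow (by positivity) (by positivity), ← Real.exp_mul,
          Real.inv_rpow (by positivity), ← Real.rpow_natCast, ← Real.rpow_natCast,
          ← Real.rpow_mul (by positivity), ← Real.rpow_mul (by positivity),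
          ← Real.rpow_neg (by positivity)]
        congr 2
        ring
    _ ≤ _ := by
        gcongr
        rw [mul_one_div, div_le_iff₀ hp0]
        linarith

lemma tsum_inv_factorial_rpow_le {p : ℝ} (hp : 1 ≤ p) :
    ∑' j : ℕ, ENNReal.ofReal ((1 / (Nat.factorial (j + 1) : ℝ)) ^ (1 / p)) ≤
      ENNReal.ofReal (Real.exp 2 * (p / Real.log (p + 1))) := by
  have hp0 : 0 < p := by linarith
  have hlog : 0 < Real.log (p + 1) := Real.log_pos (by linarith)
  obtain ⟨y, hy⟩ : ∃ y, y = (p + 1) ^ (1 / p) := ⟨_, rfl⟩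
  -- The source of `p / ln(p+1)`: the geometric series of ratio `1/y` sums to `1/(y - 1)`, and `e^x
  -- ≥ 1 + x` bounds `y - 1` below.
  have hy1 : Real.log (p + 1) / p ≤ y - 1 := by
    have h := Real.add_one_le_exp (Real.log (p + 1) / p)
    rw [hy, Real.rpow_def_of_pos (by positivity), mul_one_div]
    linarith
  have hpos : 0 < Real.log (p + 1) / p := by positivity
  have hy0 : 0 < y - 1 := hpos.trans_le hy1
  have hyp : 0 < y := by linarith
  have hyinv : y⁻¹ < 1 := inv_lt_one_of_one_lt₀ (by linarith)
  have hgeo := ((hasSum_geometric_of_lt_one (by positivity) hyinv).mul_left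
    (Real.exp 2 * y⁻¹))
  have hval : Real.exp 2 * y⁻¹ * (1 - y⁻¹)⁻¹ ≤ Real.exp 2 * (p / Real.log (p + 1)) := by
    rw [mul_assoc, ← mul_inv, mul_sub, mul_one, mul_inv_cancel₀ hyp.ne', ← inv_div (Real.log _) p]
    gcongr
  refine le_trans ?_ (ENNReal.ofReal_le_ofReal hval)
  rw [← hgeo.tsum_eq, ENNReal.ofReal_tsum_of_nonneg (fun n => by positivity) hgeo.summable]
  refine ENNReal.tsum_le_tsum fun j => ENNReal.ofReal_le_ofReal ?_
  refine (inv_factorial_rpow_le hp (j + 1)).trans (le_of_eq ?_)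
  rw [Real.rpow_neg (by positivity), ← hy, pow_succ]
  ring

lemma tailNorm_kruglovENN_indicator_le (hB : IsKruglovSequence B) {p : ℝ} (hp : 1 ≤ p)
    (A : Set unitInterval) :
    tailNorm p prodMeasure (kruglovENN B (A.indicator 1)) ≤
      ENNReal.ofReal (Real.exp 2 * (p / Real.log (p + 1))) * volume A ^ (1 / p) := by
  have hp0 : 0 < p := by linarith
  have hcover : Ioi (0 : ℝ) ⊆ ⋃ j : ℕ, Ico (j : ℝ) (j + 1) := fun τ hτ =>
    mem_iUnion.2 ⟨⌊τ⌋₊, Nat.floor_le (le_of_lt hτ), Nat.lt_floor_add_one τ⟩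
  have hA1 : volume A ≤ 1 := prob_le_one
  calc _ ≤ ∑' j : ℕ, ∫⁻ τ in Ico (j : ℝ) (j + 1),
          prodMeasure {ω | ENNReal.ofReal τ < kruglovENN B (A.indicator 1) ω} ^ (1 / p) :=
        (lintegral_mono_set hcover).trans (lintegral_iUnion_le _ _)
    _ ≤ ∑' j : ℕ, ENNReal.ofReal ((1 / (Nat.factorial (j + 1) : ℝ)) ^ (1 / p)) *
          volume A ^ (1 / p) := by
        refine ENNReal.tsum_le_tsum fun j => ?_
        calc _ ≤ ∫⁻ τ in Ico (j : ℝ) (j + 1),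
              ENNReal.ofReal ((1 / (Nat.factorial (j + 1) : ℝ)) ^ (1 / p)) *
                volume A ^ (1 / p) := by
              refine setLIntegral_mono' measurableSet_Ico fun τ hτ => ?_
              rw [← ENNReal.ofReal_rpow_of_pos (by positivity),
                ← ENNReal.mul_rpow_of_nonneg _ _ (by positivity)]
              refine ENNReal.rpow_le_rpow ?_ (by positivity)
              calc _ ≤ prodMeasure {ω | (j : ℝ≥0∞) < kruglovENN B (A.indicator 1) ω} := by
                    refine measure_mono (ofPred_subset_ofPred.2 fun ω hω => lt_of_le_of_lt ?_ hω)
                    rw [← ENNReal.ofReal_natCast]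
                    exact ENNReal.ofReal_le_ofReal hτ.1
                _ ≤ _ := tail_kruglovENN_indicator_le hB A j
                _ ≤ _ := by
                    gcongr
                    -- One factor `λ(A)` suffices, so `λ(A)^{1/p}` comes out of the sum over `j`.
                    exact pow_le_of_le_one zero_le hA1 (by omega)
          _ = _ := by simp
    _ ≤ _ := by
        rw [ENNReal.tsum_mul_right]
        gcongr
        exact tsum_inv_factorial_rpow_le hp

/-! ### Dyadic decomposition and the general estimate. -/

/-- The single term with `2^k < x ≤ 2^{k+1}` already dominates. -/
lemma le_tsum_dyadic (x : ℝ≥0∞) (hx : x ≠ ⊤) :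
    x ≤ ∑' k : ℤ, ENNReal.ofReal (2 ^ (k + 1)) *
      {y : ℝ≥0∞ | ENNReal.ofReal (2 ^ k) < y}.indicator 1 x := by
  rcases eq_or_ne x 0 with rfl | h0
  · exact zero_le
  lift x to NNReal using hx
  have hpos : 0 < (x : ℝ) := by
    have : x ≠ 0 := by simpa using h0
    positivity
  obtain ⟨k, hk⟩ := exists_mem_Ioc_zpow hpos (one_lt_two (α := ℝ))
  refine le_trans ?_ (ENNReal.le_tsum k)
  have hmem : (x : ℝ≥0∞) ∈ {y : ℝ≥0∞ | ENNReal.ofReal (2 ^ k) < y} := by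
    rw [mem_ofPred_eq, ← ENNReal.ofReal_coe_nnreal]
    exact (ENNReal.ofReal_lt_ofReal_iff hpos).2 hk.1
  rw [indicator_of_mem hmem, Pi.one_apply, mul_one, ← ENNReal.ofReal_coe_nnreal]
  exact ENNReal.ofReal_le_ofReal hk.2

/-- The tail at `2^k` is at most the tail on `(2^{k-1}, 2^k]`, whose length is a quarter of
`2^{k+1}`; these intervals are disjoint. -/
lemma tsum_dyadic_le_tailNorm {Ω : Type*} [MeasurableSpace Ω] {μ : Measure Ω} {p : ℝ}
    (hp : 1 ≤ p) (F : Ω → ℝ≥0∞) :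
    ∑' k : ℤ, ENNReal.ofReal (2 ^ (k + 1)) * μ {ω | ENNReal.ofReal (2 ^ k) < F ω} ^ (1 / p) ≤
      4 * tailNorm p μ F := by
  have hp0 : 0 < p := by linarith
  have hsub : (⋃ k : ℤ, Ioc ((2 : ℝ) ^ (k - 1)) (2 ^ k)) ⊆ Ioi 0 :=
    iUnion_subset fun k τ hτ => lt_trans (by positivity) hτ.1
  have hdisj : Pairwise (Function.onFun Disjoint fun k : ℤ => Ioc ((2 : ℝ) ^ (k - 1)) (2 ^ k)) := by
    have := (zpow_right_mono₀ (one_le_two (α := ℝ))).pairwise_disjoint_on_Ioc_pred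
    simpa using this
  calc _ ≤ ∑' k : ℤ, 4 * ∫⁻ τ in Ioc ((2 : ℝ) ^ (k - 1)) (2 ^ k),
          μ {ω | ENNReal.ofReal τ < F ω} ^ (1 / p) := by
        refine ENNReal.tsum_le_tsum fun k => ?_
        have hvol : ENNReal.ofReal ((2 : ℝ) ^ (k + 1)) =
            4 * volume (Ioc ((2 : ℝ) ^ (k - 1)) (2 ^ k)) := by
          rw [Real.volume_Ioc, show (4 : ℝ≥0∞) = ENNReal.ofReal 4 by simp,
            ← ENNReal.ofReal_mul (by norm_num), zpow_add_one₀ two_ne_zero,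
            zpow_sub_one₀ two_ne_zero]
          congr 1
          ring
        rw [hvol, mul_assoc]
        gcongr
        rw [mul_comm, ← setLIntegral_const]
        refine setLIntegral_mono' measurableSet_Ioc fun τ hτ => ?_
        exact ENNReal.rpow_le_rpow (antitone_tail μ F hτ.2) (by positivity)
    _ ≤ _ := by
        rw [ENNReal.tsum_mul_left, ← lintegral_iUnion (fun _ => measurableSet_Ioc) hdisj]
        gcongr
        exact lintegral_mono_set hsub

lemma lorentzNorm_kruglovOp_le (hB : IsKruglovSequence B) {p : ℝ} (hp : 1 ≤ p)
    {f : unitInterval → ℝ} (hf : AEMeasurable f volume) :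
    lorentzNorm (powStieltjes p hp) prodMeasure (kruglovOp B f) ≤
      ENNReal.ofReal (4 * Real.exp 2 * p / Real.log (p + 1)) *
        lorentzNorm (powStieltjes p hp) volume f := by
  have hlog : 0 < Real.log (p + 1) := Real.log_pos (by linarith)
  rw [lorentzNorm_powStieltjes, lorentzNorm_powStieltjes]
  let A : ℤ → Set unitInterval := fun k => {x | ENNReal.ofReal (2 ^ k) < ‖f x‖ₑ}
  have hA : ∀ k, NullMeasurableSet (A k) volume := fun k =>
    nullMeasurableSet_lt aemeasurable_const hf.enorm
  calc _ ≤ tailNorm p prodMeasure fun ω => ∑' k : ℤ,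
          ENNReal.ofReal (2 ^ (k + 1)) * kruglovENN B ((A k).indicator 1) ω := by
        refine tailNorm_mono hp (Filter.Eventually.of_forall fun ω => ?_)
        refine (enorm_kruglovOp_le B f ω).trans ?_
        simp only [← kruglovENN_const_mul]
        rw [← kruglovENN_tsum]
        exact kruglovENN_mono B (fun x => le_tsum_dyadic _ enorm_ne_top) ω
    _ ≤ ∑' k : ℤ, tailNorm p prodMeasure fun ω =>
          ENNReal.ofReal (2 ^ (k + 1)) * kruglovENN B ((A k).indicator 1) ω := by
        refine tailNorm_tsum_le hp fun k => AEMeasurable.const_mul ?_ _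
        exact aemeasurable_kruglovENN hB
          ((aemeasurable_const (b := (1 : ℝ≥0∞))).indicator₀ (hA k))
    _ ≤ ∑' k : ℤ, ENNReal.ofReal (Real.exp 2 * (p / Real.log (p + 1))) *
          (ENNReal.ofReal (2 ^ (k + 1)) * volume (A k) ^ (1 / p)) := by
        refine ENNReal.tsum_le_tsum fun k => ?_
        rw [tailNorm_const_mul p (by positivity), mul_left_comm]
        gcongr
        exact tailNorm_kruglovENN_indicator_le hB hp _
    _ ≤ ENNReal.ofReal (Real.exp 2 * (p / Real.log (p + 1))) *
          (4 * tailNorm p volume fun x => ‖f x‖ₑ) := by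
        rw [ENNReal.tsum_mul_left]
        gcongr
        exact tsum_dyadic_le_tailNorm hp _
    _ = _ := by
        rw [← mul_assoc, show (4 : ℝ≥0∞) = ENNReal.ofReal 4 by simp,
          ← ENNReal.ofReal_mul (by positivity)]
        congr 2
        ring

end Kruglov

theorem proposition4p3 :
    ∃ C : ℝ, 0 < C ∧
      ∀ (B : ℕ → Set unitInterval), Kruglov.IsKruglovSequence B →
      ∀ (p : ℝ) (hp : 1 ≤ p),
        (∀ f ∈ Kruglov.lorentzSpace (Kruglov.powStieltjes p hp) (volume : Measure unitInterval),
          Kruglov.kruglovOp B f ∈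
            Kruglov.lorentzSpace (Kruglov.powStieltjes p hp) Kruglov.prodMeasure) ∧
        Kruglov.lorentzOpNorm (Kruglov.powStieltjes p hp) (volume : Measure unitInterval)
            Kruglov.prodMeasure (Kruglov.kruglovOp B)
          ≤ ENNReal.ofReal (C * p / Real.log (p + 1)) := by
  -- The 4 is the dyadic loss and `e²` comes from the factorial bound.
  refine ⟨4 * Real.exp 2, by positivity, fun B hB p hp => ⟨fun f hf => ⟨?_, ?_⟩, ?_⟩⟩
  · exact Kruglov.aemeasurable_kruglovOp hB hf.1
  · exact (Kruglov.lorentzNorm_kruglovOp_le hB hp hf.1).trans_lt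
      (ENNReal.mul_lt_top ENNReal.ofReal_lt_top hf.2)
  · refine iSup₂_le fun f hf => iSup_le fun h1 => ?_
    exact (Kruglov.lorentzNorm_kruglovOp_le hB hp hf.1).trans (mul_le_of_le_one_right' h1)
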